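/- A straight-line program (SLP) for a string $s$ is an acyclic context-free grammar with exactly one rule per nonterminal that generates $s$ and no other string; its size is the total number of symbols on the right-hand sides of its rules. A run-length SLP (RLSLP) may also have rules $X\to Y^\ell$ with $\ell>1$ ($X$ expands to $\ell$ copies of $Y$), each of size $2$. Let $g^*(s)$ and $g^*_{rl}(s)$ be the sizes of the smallest SLP and of the smallest RLSLP for $s$. Let $z_{no}(s)$ be the number of phrases of the LZ77 parse of $s$ without overlaps: the string is read greedily from left to right, and the next phrase is the longest nonempty prefix of the unread part that occurs entirely inside the part already read, or a single letter if there is none. Let $z(s)$ be the same number with overlaps allowed: the earlier occurrence only has to start inside the part already read. Let $\tau_0\tau_1\tau_2\ldots=0110\,1001\ldots$ be the Thue–Morse sequence (start with $01$ and keep appending the binary negation of what has been generated), and let $t(k)$ be the string over $\{-1,0,1\}$ of the first $k$ terms of the difference sequence $\tau_1-\tau_0,\ \tau_2-\tau_1,\ \ldots$. **Theorem.** The strings $t(k)$ are square-free, and $z(s)\le z_{no}(s)$ for every string $s$. There is an infinite sequence of finite sequences $k_1,\dots,k_p$ of distinct positive integers, $k_1$ being the largest of each, with $k_1\to\infty$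 and $p=\Theta(\log k_1)$, such that the following hold, where $|_1,\dots,|_{p-1}$ are distinct separator letters that occur in no block. 1. $g^*\big(x^{k_1}|_1x^{k_2}|_2\cdots|_{p-1}x^{k_p}\big)=\Omega\big(\log^2k_1/\log\log k_1\big)$. 2. For the strings $\hat s=t(k_1)|_1t(k_2)|_2\cdots|_{p-1}t(k_p)$, with $n=|\hat s|$, $$\frac{g^*_{rl}(\hat s)}{z_{no}(\hat s)}=\Omega\!\left(\frac{\log n}{\log\log n}\right)\qquad\text{and}\qquad\frac{g^*_{rl}(\hat s)}{z(\hat s)}=\Omega\!\left(\frac{\log n}{\log\log n}\right).$$ In particular the smallest RLSLP does not always match the LZ77 parse, with or without overlaps, up to a constant factor. -/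

import Mathlib

open Filter Asymptotics

section Grammars

/-- The right-hand side of a rule of a run-length straight-line program, with terminals in `α` and
nonterminals in `V`: either an ordinary word of symbols, or a power `Y ^ ℓ` of one symbol with
`ℓ > 1`. -/
inductive RLRule (α : Type*) (V : Type) where
  | word (w : List (α ⊕ V)) : RLRule α V
  | run (Y : α ⊕ V) (ℓ : ℕ) (hℓ : 1 < ℓ) : RLRule α V

/-- Size of a right-hand side: the number of its symbols; a power `Y ^ ℓ` is written with the two
symbols `Y` and `ℓ`. -/
def RLRule.size {α : Type*} {V : Type} : RLRule α V → ℕ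
  | .word w => w.length
  | .run _ _ _ => 2

/-- A right-hand side is ordinary if it is not a power. -/
def RLRule.IsWord {α : Type*} {V : Type} : RLRule α V → Prop
  | .word _ => True
  | .run _ _ _ => False

/-- A run-length straight-line program (RLSLP) over the alphabet `α`: finitely many nonterminals,
numbered `0, …, m - 1`, one of which is the start symbol, and exactly one rule for each of them.
The grammar is acyclic: the rule of `i` mentions only nonterminals `j < i`. -/
structure RLSLP (α : Type*) where
  m : ℕ
  start : Fin m
  rule : (i : Fin m) → RLRule α (Fin i.val)

namespace RLSLP

variable {α : Type*}

/-- The string generated by a nonterminal. -/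
def expand (G : RLSLP α) (i : Fin G.m) : List α :=
  match G.rule i with
  | .word w => w.flatMap fun s => match s with
    | .inl a => [a]
    | .inr j => G.expand ⟨j.val, j.isLt.trans i.isLt⟩
  | .run (.inl a) ℓ _ => List.replicate ℓ a
  | .run (.inr j) ℓ _ => (List.replicate ℓ (G.expand ⟨j.val, j.isLt.trans i.isLt⟩)).flatten
termination_by i.val

/-- The string generated by the grammar. -/
def text (G : RLSLP α) : List α := G.expand G.start

/-- The size of a grammar: the total size of the right-hand sides of its rules. -/
def size (G : RLSLP α) : ℕ := ∑ i, (G.rule i).size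

/-- A straight-line program (SLP) is an RLSLP without run-length rules. -/
def IsSLP (G : RLSLP α) : Prop := ∀ i, (G.rule i).IsWord

end RLSLP

/-- The size `g*` of the smallest SLP that generates `s`. -/
noncomputable def minSLPSize {α : Type*} (s : List α) : ℕ :=
  sInf {g : ℕ | ∃ G : RLSLP α, G.IsSLP ∧ G.text = s ∧ G.size = g}

/-- The size `g*_rl` of the smallest RLSLP that generates `s`. -/
noncomputable def minRLSLPSize {α : Type*} (s : List α) : ℕ :=
  sInf {g : ℕ | ∃ G : RLSLP α, G.text = s ∧ G.size = g}

/-- Every string is generated by an SLP, so both minima are taken over nonempty sets. -/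
theorem exists_SLP {α : Type*} (s : List α) : ∃ G : RLSLP α, G.IsSLP ∧ G.text = s := by
  refine ⟨⟨1, 0, fun _ => .word (s.map Sum.inl)⟩, fun _ => trivial, ?_⟩
  rw [RLSLP.text, RLSLP.expand]
  simp [List.flatMap_map]

end Grammars

section LempelZiv

/-- Without overlaps: the prefix of length `j` of the unread part `v` occurs inside the part `u`
already read. -/
def HasSourceNo {α : Type*} (u v : List α) (j : ℕ) : Prop := v.take j <:+: u

/-- With overlaps: the prefix of length `j` of the unread part `v` has an occurrence in `u ++ v` that
starts inside `u`; it may run into `v`. -/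
def HasSource {α : Type*} (u v : List α) (j : ℕ) : Prop :=
  ∃ i < u.length, v.take j <+: (u ++ v).drop i

open Classical in
/-- Length of the next greedy phrase: the largest `j ≤ |v|` for which the prefix of length `j` of
the unread part `v` has a source; a letter without a source is a phrase of length `1`. -/
noncomputable def phraseLen {α : Type*} (src : List α → List α → ℕ → Prop) (u v : List α) : ℕ :=
  max 1 (Nat.findGreatest (src u v) v.length)

theorem one_le_phraseLen {α : Type*} (src : List α → List α → ℕ → Prop) (u v : List α) :
    1 ≤ phraseLen src u v := le_max_left _ _

/-- The greedy left-to-right parse of the unread part `v`, after `u` has been read. -/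
noncomputable def lzParse {α : Type*} (src : List α → List α → ℕ → Prop) (u v : List α) :
    List (List α) :=
  if _h : v = [] then []
  else v.take (phraseLen src u v) ::
    lzParse src (u ++ v.take (phraseLen src u v)) (v.drop (phraseLen src u v))
termination_by v.length
decreasing_by
  have h1 := one_le_phraseLen src u v
  have h2 := List.length_pos_iff.mpr _h
  rw [List.length_drop]
  omega

/-- `z_no`: the number of phrases of the LZ77 parse without overlaps. -/
noncomputable def lzNo {α : Type*} (s : List α) : ℕ := (lzParse HasSourceNo [] s).length

/-- `z`: the number of phrases of the LZ77 parse with overlaps. -/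
noncomputable def lz {α : Type*} (s : List α) : ℕ := (lzParse HasSource [] s).length

end LempelZiv

section Strings

/-- The prefix of length `2 ^ (m + 1)` of the Thue–Morse sequence: start with `01` and keep
appending the binary negation. -/
def thueMorsePrefix : ℕ → List ℤ
  | 0 => [0, 1]
  | m + 1 => thueMorsePrefix m ++ (thueMorsePrefix m).map fun b => 1 - b

/-- The Thue–Morse sequence, indexed from `0`; the prefix used has length `2 ^ (n + 1) > n`. -/
def thueMorse (n : ℕ) : ℤ := (thueMorsePrefix n).getD n 0

/-- The string `t(k)`: the first `k` terms of the sequence of differences of consecutive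
Thue–Morse terms. -/
def diffThueMorse (k : ℕ) : List ℤ :=
  (List.range k).map fun i => thueMorse (i + 1) - thueMorse i

/-- The string `w 1 |₁ w 2 |₂ … |ₚ₋₁ w p`, for `p ≥ 1`. The letters of the blocks are `inl a`, and
the separator `|ᵢ` is the letter `inr i`. -/
def separated {α : Type*} (p : ℕ) (w : ℕ → List α) : List (α ⊕ ℕ) :=
  (w 1).map Sum.inl ++
    (List.range (p - 1)).flatMap fun i => Sum.inr (i + 1) :: (w (i + 2)).map Sum.inl

/-- The string `x^(k 1) |₁ x^(k 2) |₂ … |ₚ₋₁ x^(k p)`. -/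
def unaryString (p : ℕ) (k : ℕ → ℕ) : List (Unit ⊕ ℕ) :=
  separated p fun i => List.replicate (k i) ()

/-- The string `t(k 1) |₁ t(k 2) |₂ … |ₚ₋₁ t(k p)`. -/
def diffString (p : ℕ) (k : ℕ → ℕ) : List (ℤ ⊕ ℕ) :=
  separated p fun i => diffThueMorse (k i)

end Strings

/-! The lower bound is a counting argument. Fix `k 1 = 4 ^ j` and let each of the next `j` exponents
vary freely in its own interval of length `2 ^ j`. The separators make the `2 ^ (j * j)` resulting
unary strings distinct. An SLP of size `g` amounts to `g` concatenations starting from about `j`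
letters, so SLPs of size at most `g` yield at most `(j + 3 + g) ^ (2 * g + 1)` of these strings.
Hence some choice of exponents needs size of order `j ^ 2 / log j` (`exists_exponents`). Since `log
(k 1)` is of order `j`, this is the first bound.

To pass to RLSLPs, replace `x ^ k` by the square-free `t(k)`. A power inside a square-free string
generates only the empty string, so all powers can be dropped. Renaming every letter of the blocks
to `x` then turns the grammar into an SLP for the unary string (`minSLPSize_unaryString_le`).

LZ77 handles the same strings cheaply. Each later `t(k)` is a prefix of the first block and costs
two phrases with its separator, and the first block costs `O(j)` phrases because a bounded number of
copies doubles a Thue–Morse prefix. Greedy parsing is optimal, so `z ≤ z_no = O(j)`, and the ratio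
is of order at least `j / log j`, with `log n` of order `j`. -/

namespace RLSLP

variable {α β : Type*}

/-- The string generated by a symbol on the right-hand side of the rule of `i`. -/
def symbolText (G : RLSLP α) (i : Fin G.m) : α ⊕ Fin i.val → List α
  | .inl a => [a]
  | .inr j => G.expand ⟨j.val, j.isLt.trans i.isLt⟩

theorem expand_of_word (G : RLSLP α) {i : Fin G.m} {w : List (α ⊕ Fin i.val)}
    (h : G.rule i = .word w) : G.expand i = w.flatMap (G.symbolText i) := by
  rw [expand, h]
  refine congrArg (fun v => List.flatMap v w) (funext fun s => ?_)
  cases s <;> rfl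

theorem expand_of_run (G : RLSLP α) {i : Fin G.m} {Y : α ⊕ Fin i.val} {ℓ : ℕ} {hℓ : 1 < ℓ}
    (h : G.rule i = .run Y ℓ hℓ) :
    G.expand i = (List.replicate ℓ (G.symbolText i Y)).flatten := by
  rw [expand, h]
  cases Y with
  | inl a => exact List.flatten_replicate_singleton.symm
  | inr j => rfl

end RLSLP

/-! ### Counting the strings with small SLPs -/

section Chains

variable {α β : Type*}

open Classical in
/-- The sets of strings obtained from the set `A` by adding, `t` times, the concatenation of two
strings that are already present. -/
noncomputable def chainSets (A : Finset (List β)) : ℕ → Finset (Finset (List β))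
  | 0 => {A}
  | t + 1 => (chainSets A t).biUnion fun S =>
      (S ×ˢ S).image fun q => insert (q.1 ++ q.2) S

open Classical in
theorem insert_mem_chainSets {A S : Finset (List β)} {t : ℕ} (hS : S ∈ chainSets A t)
    {x y : List β} (hx : x ∈ S) (hy : y ∈ S) : insert (x ++ y) S ∈ chainSets A (t + 1) := by
  simp only [chainSets, Finset.mem_biUnion, Finset.mem_image, Finset.mem_product]
  exact ⟨S, hS, (x, y), ⟨hx, hy⟩, rfl⟩

theorem subset_of_mem_chainSets {A S : Finset (List β)} {t : ℕ} (hS : S ∈ chainSets A t) :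
    A ⊆ S := by
  classical
  induction t generalizing S with
  | zero => simp only [chainSets, Finset.mem_singleton] at hS; rw [hS]
  | succ t ih =>
    simp only [chainSets, Finset.mem_biUnion, Finset.mem_image] at hS
    obtain ⟨T, hT, q, -, rfl⟩ := hS
    exact (ih hT).trans (Finset.subset_insert _ _)

theorem card_of_mem_chainSets {A S : Finset (List β)} {t : ℕ} (hS : S ∈ chainSets A t) :
    S.card ≤ A.card + t := by
  classical
  induction t generalizing S with
  | zero => simp only [chainSets, Finset.mem_singleton] at hS; rw [hS]; rfl
  | succ t ih =>
    simp only [chainSets, Finset.mem_biUnion, Finset.mem_image] at hS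
    obtain ⟨T, hT, q, -, rfl⟩ := hS
    have := ih hT
    have := Finset.card_insert_le (q.1 ++ q.2) T
    omega

/-- Each step is determined by an ordered pair from a set of at most `A.card + t` strings. -/
theorem card_chainSets_le (A : Finset (List β)) (t : ℕ) :
    (chainSets A t).card ≤ (A.card + t) ^ (2 * t) := by
  classical
  induction t with
  | zero => simp [chainSets]
  | succ t ih =>
    have h1 : (chainSets A (t + 1)).card ≤ (chainSets A t).card * (A.card + t) ^ 2 := by
      refine Finset.card_biUnion_le_card_mul _ _ _ fun S hS => ?_
      refine Finset.card_image_le.trans ?_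
      rw [Finset.card_product, ← sq]
      exact Nat.pow_le_pow_left (card_of_mem_chainSets hS) 2
    calc _ ≤ _ := h1
      _ ≤ (A.card + t) ^ (2 * t) * (A.card + t) ^ 2 := Nat.mul_le_mul_right _ ih
      _ = (A.card + t) ^ (2 * (t + 1)) := by ring
      _ ≤ _ := Nat.pow_le_pow_left (by omega) _

/-- Concatenating `[]` with itself adds nothing, so short computations can be padded to a common
length. -/
theorem chainSets_mono {A : Finset (List β)} (hA : [] ∈ A) : Monotone (chainSets A) := by
  classical
  refine monotone_nat_of_le_succ fun t S hS => ?_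
  have h0 := subset_of_mem_chainSets hS hA
  simpa [Finset.insert_eq_of_mem h0] using insert_mem_chainSets hS h0 h0

open Classical in
/-- The strings that can be computed from `A` with `t` concatenations. -/
noncomputable def chainStrings (A : Finset (List β)) (t : ℕ) : Finset (List β) :=
  (chainSets A t).biUnion id

theorem card_chainStrings_le (A : Finset (List β)) (t : ℕ) :
    (chainStrings A t).card ≤ (A.card + t) ^ (2 * t + 1) := by
  classical
  have h := Finset.card_biUnion_le_card_mul (chainSets A t) id (A.card + t)
    fun S hS => card_of_mem_chainSets hS
  refine h.trans ?_
  rw [pow_succ]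
  exact Nat.mul_le_mul_right _ (card_chainSets_le A t)

/-- The string `x` is the product accumulated so far. Starting from `x = []`, a rule costs one
concatenation per symbol, exactly its size. -/
theorem exists_chainSet_word {γ : Type*} {A : Finset (List β)} (v : γ → List β) (w : List γ)
    {t : ℕ} {S : Finset (List β)} (hS : S ∈ chainSets A t) (hv : ∀ s ∈ w, v s ∈ S)
    {x : List β} (hx : x ∈ S) :
    ∃ T ∈ chainSets A (t + w.length), S ⊆ T ∧ x ++ w.flatMap v ∈ T := by
  classical
  induction w generalizing t S x with
  | nil => exact ⟨S, hS, subset_rfl, by simpa using hx⟩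
  | cons s w ih =>
    have h1 := insert_mem_chainSets hS hx (hv s (by simp))
    obtain ⟨T, hT, hST, hxT⟩ := ih h1
      (fun r hr => Finset.mem_insert_of_mem (hv r (by simp [hr]))) (Finset.mem_insert_self _ _)
    refine ⟨T, ?_, (Finset.subset_insert _ _).trans hST, by simpa using hxT⟩
    rwa [List.length_cons, add_comm w.length, ← add_assoc]

/-- The strings generated by the nonterminals of an SLP of size `g`, with the letters replaced
according to `h`, can be computed with `g` concatenations. -/
theorem RLSLP.IsSLP.exists_chainSet {G : RLSLP α} (hG : G.IsSLP) {A : Finset (List β)}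
    (hA : [] ∈ A) (h : α → List β) (hh : ∀ a, h a ∈ A) (k : ℕ) (hk : k ≤ G.m) :
    ∃ S ∈ chainSets A (∑ i : Fin G.m with i.val < k, (G.rule i).size),
      ∀ i : Fin G.m, i.val < k → (G.expand i).flatMap h ∈ S := by
  classical
  induction k with
  | zero => exact ⟨A, by simp [chainSets], fun i hi => absurd hi (by omega)⟩
  | succ k ih =>
    obtain ⟨S, hS, hSi⟩ := ih (by omega)
    set i₀ : Fin G.m := ⟨k, hk⟩
    have hfilter : (Finset.univ.filter fun i : Fin G.m => i.val < k + 1) =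
        insert i₀ (Finset.univ.filter fun i : Fin G.m => i.val < k) := by
      ext i
      simp only [Finset.mem_filter, Finset.mem_univ, true_and, Finset.mem_insert, Fin.ext_iff, i₀]
      omega
    rw [hfilter, Finset.sum_insert (by simp [i₀]), add_comm]
    have hw := hG i₀
    cases hr : G.rule i₀ with
    | run Y ℓ hℓ => rw [hr] at hw; exact hw.elim
    | word w =>
      obtain ⟨T, hT, hST, hxT⟩ := exists_chainSet_word
        (fun s => (G.symbolText i₀ s).flatMap h) w hS (by
          rintro (a | j) -
          · simpa [RLSLP.symbolText] using subset_of_mem_chainSets hS (hh a)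
          · exact hSi _ j.isLt) (subset_of_mem_chainSets hS hA)
      refine ⟨T, hT, fun i hi => ?_⟩
      rcases Nat.lt_succ_iff_lt_or_eq.mp hi with h' | h'
      · exact hST (hSi i h')
      · obtain rfl : i = i₀ := Fin.ext h'
        rw [G.expand_of_word hr, List.flatMap_assoc]
        simpa using hxT

theorem mem_chainStrings_of_minSLPSize_le {A : Finset (List α)} (hA : [] ∈ A) {s : List α}
    (hs : ∀ a ∈ s, [a] ∈ A) {g : ℕ} (hg : minSLPSize s ≤ g) : s ∈ chainStrings A g := by
  classical
  obtain ⟨G, hG, hGs, hsize⟩ : minSLPSize s ∈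
      {g : ℕ | ∃ G : RLSLP α, G.IsSLP ∧ G.text = s ∧ G.size = g} := by
    obtain ⟨G, hG, hGs⟩ := exists_SLP s
    exact Nat.sInf_mem ⟨_, G, hG, hGs, rfl⟩
  -- Rules that do not contribute to `s` may contain letters outside `A`; these are erased, which
  -- leaves `s` itself unchanged.
  obtain ⟨S, hS, hSi⟩ := hG.exists_chainSet hA (fun a => if [a] ∈ A then [a] else [])
    (fun a => by split_ifs <;> assumption) G.m le_rfl
  have hsum : (∑ i : Fin G.m with i.val < G.m, (G.rule i).size) = G.size := by
    simp [RLSLP.size]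
  rw [hsum, hsize] at hS
  refine Finset.mem_biUnion.mpr ⟨S, chainSets_mono hA hg hS, ?_⟩
  have hmem := hSi G.start G.start.isLt
  have h2 : (G.expand G.start).flatMap (fun a => if [a] ∈ A then [a] else []) = s := by
    have h3 : G.expand G.start = s := hGs
    rw [h3]
    clear hmem h3 hGs hsize hg hS
    induction s with
    | nil => rfl
    | cons a s ih => simp [hs a (by simp), ih fun b hb => hs b (by simp [hb])]
  rwa [h2] at hmem

end Chains

/-! ### Eliminating powers from grammars for square-free strings -/

section SquareFree

variable {α β : Type*}

/-- A string is square-free if it has no nonempty factor of the form `u ++ u`. -/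
def SquareFreeList (s : List α) : Prop := ∀ u, u ++ u <:+: s → u = []

/-- Drop the powers of a grammar and rename its letters. -/
def RLRule.toWord {V : Type} (f : α → β) : RLRule α V → RLRule β V
  | .word w => .word (w.map (Sum.map f id))
  | .run _ _ _ => .word []

/-- Drop the powers of a grammar and rename its letters. -/
abbrev RLSLP.toSLP (f : α → β) (G : RLSLP α) : RLSLP β where
  m := G.m
  start := G.start
  rule i := (G.rule i).toWord f

theorem RLSLP.toSLP_isSLP (f : α → β) (G : RLSLP α) : (G.toSLP f).IsSLP := by
  intro i
  simp only [toSLP]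
  cases G.rule i <;> trivial

theorem RLSLP.size_toSLP_le (f : α → β) (G : RLSLP α) : (G.toSLP f).size ≤ G.size := by
  refine Finset.sum_le_sum fun i _ => ?_
  simp only [toSLP]
  cases G.rule i <;> simp [RLRule.toWord, RLRule.size]

/-- Induction along the acyclic order: being a factor of `s` passes to the symbols of a word rule.
Nonterminals that do not generate a factor of `s` may change their meaning. -/
theorem RLSLP.expand_toSLP (f : α → β) (G : RLSLP α) {s : List α} (hs : SquareFreeList s)
    (i : Fin G.m) (hi : G.expand i <:+: s) :
    (G.toSLP f).expand i = (G.expand i).map f := by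
  obtain ⟨n, hn⟩ := i
  induction n using Nat.strong_induction_on with
  | _ n ih =>
  cases hr : G.rule ⟨n, hn⟩ with
  | word w =>
    have hr' : (G.toSLP f).rule ⟨n, hn⟩ = .word (w.map (Sum.map f id)) := by
      simp only [toSLP, hr, RLRule.toWord]
    rw [RLSLP.expand_of_word _ hr] at hi ⊢
    rw [RLSLP.expand_of_word _ hr', List.flatMap_map, List.map_flatMap]
    refine List.flatMap_congr fun s hsw => ?_
    have hinf : G.symbolText ⟨n, hn⟩ s <:+: w.flatMap (G.symbolText ⟨n, hn⟩) := by
      obtain ⟨w₁, w₂, rfl⟩ := List.append_of_mem hsw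
      exact ⟨w₁.flatMap (G.symbolText ⟨n, hn⟩), w₂.flatMap (G.symbolText ⟨n, hn⟩), by simp⟩
    rcases s with a | j
    · rfl
    · exact ih j.val j.isLt _ (hinf.trans hi)
  | run Y ℓ hℓ =>
    have hr' : (G.toSLP f).rule ⟨n, hn⟩ = .word [] := by
      simp only [toSLP, hr, RLRule.toWord]
    rw [RLSLP.expand_of_run _ hr] at hi ⊢
    rw [RLSLP.expand_of_word _ hr']
    -- As `ℓ > 1`, the power begins with a square of the text of `Y`.
    have h0 : G.symbolText ⟨n, hn⟩ Y = [] := by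
      refine hs _ (List.IsInfix.trans ?_ hi)
      obtain ⟨l, rfl⟩ := Nat.exists_eq_add_of_le' hℓ
      refine ⟨[], (List.replicate l (G.symbolText ⟨n, hn⟩ Y)).flatten, ?_⟩
      simp [List.replicate_succ]
    simp [h0]

/-- Powers are useless for the generation of a square-free string. -/
theorem minSLPSize_map_le_minRLSLPSize (f : α → β) {s : List α} (hs : SquareFreeList s) :
    minSLPSize (s.map f) ≤ minRLSLPSize s := by
  obtain ⟨G, hGs, hsize⟩ : minRLSLPSize s ∈ {g : ℕ | ∃ G : RLSLP α, G.text = s ∧ G.size = g} := by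
    obtain ⟨G, -, hGs⟩ := exists_SLP s
    exact Nat.sInf_mem ⟨_, G, hGs, rfl⟩
  rw [← hsize]
  have h : G.expand G.start = s := hGs
  have htext : (G.toSLP f).text = s.map f := by
    have := G.expand_toSLP f hs G.start (h ▸ List.infix_rfl)
    rwa [h] at this
  have hle : minSLPSize (s.map f) ≤ (G.toSLP f).size :=
    Nat.sInf_le ⟨G.toSLP f, G.toSLP_isSLP f, htext, rfl⟩
  exact hle.trans (G.size_toSLP_le f)

end SquareFree

/-! ### Optimality of the greedy parse -/

section Factors

variable {α β : Type*}

/-- After `u` has been read, `w` can be read in `r` phrases, each of them of length at most `1` or a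
factor of the part already read. -/
inductive Factors : List α → List α → ℕ → Prop
  | nil (u : List α) : Factors u [] 0
  | cons {u w₁ w₂ : List α} {r : ℕ} (h : w₁.length ≤ 1 ∨ w₁ <:+: u)
      (h' : Factors (u ++ w₁) w₂ r) : Factors u (w₁ ++ w₂) (r + 1)

theorem Factors.append {u w w' : List α} {r r' : ℕ} (h : Factors u w r)
    (h' : Factors (u ++ w) w' r') : Factors u (w ++ w') (r + r') := by
  induction h with
  | nil u => simpa using h'
  | cons h _ ih =>
    rw [List.append_assoc, add_right_comm]
    exact Factors.cons h (ih (by simpa using h'))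

theorem Factors.singleton (u : List α) (a : α) : Factors u [a] 1 := by
  simpa using Factors.cons (u := u) (w₁ := [a]) (Or.inl (by simp)) (Factors.nil _)

theorem Factors.of_infix {u w : List α} (h : w <:+: u) : Factors u w 1 := by
  simpa using Factors.cons (Or.inr h) (Factors.nil (u ++ w))

theorem Factors.map (f : α → β) {u w : List α} {r : ℕ} (h : Factors u w r) :
    Factors (u.map f) (w.map f) r := by
  induction h with
  | nil u => exact Factors.nil _
  | cons h _ ih =>
    rw [List.map_append]
    refine Factors.cons (h.imp (by simp) fun h => h.map f) ?_
    simpa using ih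

/-- The greedy parse is the shortest one. -/
theorem Factors.length_lzParse_le {src : List α → List α → ℕ → Prop}
    (hsrc : ∀ u v w, w ≠ [] → w <+: v → w <:+: u → src u v w.length)
    {u w : List α} {r : ℕ} (h : Factors u w r) {u' v : List α} (he : u ++ w = u' ++ v)
    (hle : u.length ≤ u'.length) : (lzParse src u' v).length ≤ r := by
  classical
  induction h generalizing u' v with
  | nil u =>
    have hv : v = [] := by
      have := congrArg List.length he
      simp only [List.length_append, List.length_nil] at this
      exact List.length_eq_zero_iff.mp (by omega)
    rw [lzParse]
    simp [hv]
  | @cons u w₁ w₂ r h _ ih =>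
    by_cases hv : v = []
    · rw [lzParse]
      simp [hv]
    rw [lzParse]
    simp only [hv, dite_false, List.length_cons, Nat.add_le_add_iff_right]
    -- Invariant: after equally many phrases, the greedy parse has read at least as far as the given
    -- one.
    refine ih (by simpa using he) ?_
    have h1 := one_le_phraseLen src u' v
    have hv' := List.length_pos_iff.mpr hv
    simp only [List.length_append, List.length_take]
    rcases h with h | h
    · omega
    by_cases hcase : u.length + w₁.length ≤ u'.length
    · omega
    have hu : u <+: u' := List.prefix_of_prefix_length_le (List.prefix_append u (w₁ ++ w₂))
      (he ▸ List.prefix_append u' v) hle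
    obtain ⟨x, rfl⟩ := hu
    rw [List.append_assoc, List.append_cancel_left_eq] at he
    simp only [List.length_append] at hcase ⊢
    have hx : x <+: w₁ := List.prefix_of_prefix_length_le (List.prefix_append x v)
      (he ▸ List.prefix_append w₁ w₂) (by omega)
    obtain ⟨y, rfl⟩ := hx
    rw [List.append_assoc, List.append_cancel_left_eq] at he
    simp only [List.length_append] at hcase ⊢
    have hyv : y <+: v := he ▸ List.prefix_append y w₂
    have hy : y ≠ [] := by rintro rfl; simp at hcase
    -- The greedy position lies inside `w₁ = x ++ y`. The rest `y` still has a source in `u`, so the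
    -- greedy phrase reaches at least the end of `w₁`.
    have hs := hsrc (u ++ x) v y hy hyv
      (((List.suffix_append x y).isInfix.trans h).trans (List.prefix_append u x).isInfix)
    have h2 : y.length ≤ phraseLen src (u ++ x) v :=
      le_max_of_le_right (Nat.le_findGreatest hyv.length_le hs)
    have := hyv.length_le
    omega

theorem hasSourceNo_of_infix (u v w : List α) (_ : w ≠ []) (hv : w <+: v) (hu : w <:+: u) :
    HasSourceNo u v w.length := by
  rwa [HasSourceNo, ← List.prefix_iff_eq_take.mp hv]

theorem hasSource_of_infix (u v w : List α) (hw : w ≠ []) (hv : w <+: v) (hu : w <:+: u) :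
    HasSource u v w.length := by
  rw [HasSource, ← List.prefix_iff_eq_take.mp hv]
  obtain ⟨a, b, rfl⟩ := hu
  refine ⟨a.length, ?_, ?_⟩
  · have := List.length_pos_iff.mpr hw
    simp only [List.length_append]
    omega
  · simp

theorem Factors.lzNo_le {s : List α} {r : ℕ} (h : Factors [] s r) : lzNo s ≤ r :=
  h.length_lzParse_le hasSourceNo_of_infix rfl le_rfl

theorem factors_lzParse (u v : List α) : Factors u v (lzParse HasSourceNo u v).length := by
  classical
  induction hn : v.length using Nat.strong_induction_on generalizing u v with
  | _ n ih =>
  rw [lzParse]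
  split_ifs with hv
  · rw [hv]; exact Factors.nil u
  · have h1 := one_le_phraseLen HasSourceNo u v
    have hv' := List.length_pos_iff.mpr hv
    have h2 := ih (v.drop (phraseLen HasSourceNo u v)).length
      (by rw [List.length_drop]; omega) (u ++ v.take (phraseLen HasSourceNo u v))
      (v.drop (phraseLen HasSourceNo u v)) rfl
    have h3 := Factors.cons (u := u) (w₁ := v.take (phraseLen HasSourceNo u v)) (by
      by_cases hg : phraseLen HasSourceNo u v ≤ 1
      · exact Or.inl (by rw [List.length_take]; omega)
      · right
        have h4 : phraseLen HasSourceNo u v = Nat.findGreatest (HasSourceNo u v) v.length := by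
          unfold phraseLen at hg ⊢
          omega
        exact Nat.findGreatest_of_ne_zero h4.symm (by omega)) h2
    rwa [List.take_append_drop] at h3

/-- The greedy parse without overlaps is an admissible competitor of the greedy parse with overlaps.
-/
theorem lz_le_lzNo (s : List α) : lz s ≤ lzNo s :=
  (factors_lzParse [] s).length_lzParse_le hasSource_of_infix rfl le_rfl

theorem lz_pos {s : List α} (hs : s ≠ []) : 0 < lz s := by
  rw [lz, lzParse]
  simp [hs]

end Factors

/-! ### Square-freeness and cheap parsing of the Thue–Morse differences -/

section ThueMorse

theorem length_thueMorsePrefix (m : ℕ) : (thueMorsePrefix m).length = 2 ^ (m + 1) := by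
  induction m with
  | zero => rfl
  | succ m ih => simp [thueMorsePrefix, ih]; ring

theorem thueMorsePrefix_getD_add (m d i : ℕ) (hi : i < 2 ^ (m + 1)) :
    (thueMorsePrefix (m + d)).getD i 0 = (thueMorsePrefix m).getD i 0 := by
  induction d with
  | zero => rfl
  | succ d ih =>
    rw [← ih, ← add_assoc, thueMorsePrefix, List.getD_append]
    rw [length_thueMorsePrefix]
    exact hi.trans_le (Nat.pow_le_pow_right (by norm_num) (by omega))

theorem thueMorsePrefix_getD (m i : ℕ) (hi : i < 2 ^ (m + 1)) :
    (thueMorsePrefix m).getD i 0 = thueMorse i := by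
  have h0 : i < 2 ^ (i + 1) := Nat.lt_two_pow_self.trans
    (Nat.pow_lt_pow_right (by norm_num) (by omega))
  rcases le_total m i with h | h
  · obtain ⟨d, rfl⟩ := Nat.exists_eq_add_of_le h
    exact (thueMorsePrefix_getD_add m d _ hi).symm
  · obtain ⟨d, rfl⟩ := Nat.exists_eq_add_of_le h
    exact thueMorsePrefix_getD_add i d i h0

theorem thueMorse_two_pow_add (m i : ℕ) (hi : i < 2 ^ m) :
    thueMorse (2 ^ m + i) = 1 - thueMorse i := by
  rcases m with - | m
  · obtain rfl : i = 0 := by simpa using hi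
    rfl
  rw [← thueMorsePrefix_getD (m + 1) (2 ^ (m + 1) + i) (by rw [pow_succ 2 (m + 1)]; omega),
    thueMorsePrefix, List.getD_append_right _ _ _ _ (by rw [length_thueMorsePrefix]; omega),
    length_thueMorsePrefix, Nat.add_sub_cancel_left, ← thueMorsePrefix_getD m i hi]
  have hl : i < (thueMorsePrefix m).length := by rwa [length_thueMorsePrefix]
  simp [List.getD_eq_getElem?_getD, hl]

theorem exists_eq_two_pow_add {n : ℕ} (hn : n ≠ 0) : ∃ m i, i < 2 ^ m ∧ n = 2 ^ m + i := by
  refine ⟨Nat.log 2 n, n - 2 ^ Nat.log 2 n, ?_, ?_⟩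
  · have := Nat.lt_pow_succ_log_self (b := 2) (by norm_num) n
    have := Nat.pow_log_le_self 2 hn
    rw [pow_succ] at *
    omega
  · have := Nat.pow_log_le_self 2 hn
    omega

theorem thueMorse_eq_zero_or_one (n : ℕ) : thueMorse n = 0 ∨ thueMorse n = 1 := by
  induction n using Nat.strong_induction_on with
  | _ n ih =>
  rcases eq_or_ne n 0 with rfl | hn
  · exact Or.inl rfl
  · obtain ⟨m, i, hi, rfl⟩ := exists_eq_two_pow_add hn
    rw [thueMorse_two_pow_add m i hi]
    have := ih i (by omega)
    omega

theorem thueMorse_double (n : ℕ) :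
    thueMorse (2 * n) = thueMorse n ∧ thueMorse (2 * n + 1) = 1 - thueMorse n := by
  induction n using Nat.strong_induction_on with
  | _ n ih =>
  rcases eq_or_ne n 0 with rfl | hn
  · exact ⟨rfl, rfl⟩
  · obtain ⟨m, i, hi, rfl⟩ := exists_eq_two_pow_add hn
    obtain ⟨h1, h2⟩ := ih i (by have := Nat.two_pow_pos m; omega)
    have e : 2 * (2 ^ m + i) = 2 ^ (m + 1) + 2 * i := by ring
    rw [e, add_assoc, thueMorse_two_pow_add (m + 1) (2 * i) (by rw [pow_succ]; omega),
      thueMorse_two_pow_add (m + 1) (2 * i + 1) (by rw [pow_succ]; omega),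
      thueMorse_two_pow_add m i hi, h1, h2]
    exact ⟨rfl, rfl⟩

/-- One of the two adjacent pairs starts at an even index, where the terms are complementary. -/
theorem thueMorse_not_three_equal (c : ℕ) :
    ¬ (thueMorse c = thueMorse (c + 1) ∧ thueMorse (c + 1) = thueMorse (c + 2)) := by
  rintro ⟨h1, h2⟩
  obtain ⟨b, rfl | rfl⟩ := Nat.even_or_odd' c
  · have := thueMorse_double b
    have := thueMorse_eq_zero_or_one b
    omega
  · have h3 := thueMorse_double (b + 1)
    have := thueMorse_eq_zero_or_one (b + 1)
    rw [show 2 * (b + 1) = 2 * b + 1 + 1 by ring, show 2 * b + 1 + 1 + 1 = 2 * b + 1 + 2 by ring] at h3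
    omega

theorem thueMorse_ne_of_even (b : ℕ) : thueMorse (2 * b) ≠ thueMorse (2 * b + 1) := by
  have := thueMorse_double b
  have := thueMorse_eq_zero_or_one b
  omega

theorem thueMorse_eq_of_odd {c : ℕ} (h : thueMorse (2 * c + 1) ≠ thueMorse (2 * c + 2)) :
    thueMorse c = thueMorse (c + 1) := by
  have h1 := thueMorse_double c
  have h2 := thueMorse_double (c + 1)
  rw [show 2 * (c + 1) = 2 * c + 2 by ring] at h2
  have := thueMorse_eq_zero_or_one c
  have := thueMorse_eq_zero_or_one (c + 1)
  omega

/-- The Thue–Morse sequence is overlap-free. -/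
theorem thueMorse_overlapFree (q : ℕ) (hq : 0 < q) (i : ℕ) :
    ¬ ∀ j ≤ q, thueMorse (i + j) = thueMorse (i + j + q) := by
  induction q using Nat.strong_induction_on generalizing i with
  | _ q ih =>
  intro h
  obtain ⟨r, rfl | rfl⟩ := Nat.even_or_odd' q
  -- Even period: every second term gives an overlap with half the period.
  · obtain ⟨a, rfl | rfl⟩ := Nat.even_or_odd' i
    · refine ih r (by omega) (by omega) a fun j hj => ?_
      have h1 := h (2 * j) (by omega)
      rw [show 2 * a + 2 * j + 2 * r = 2 * (a + j + r) by ring,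
        show 2 * a + 2 * j = 2 * (a + j) by ring] at h1
      rwa [(thueMorse_double _).1, (thueMorse_double _).1] at h1
    · refine ih r (by omega) (by omega) a fun j hj => ?_
      have h1 := h (2 * j) (by omega)
      rw [show 2 * a + 1 + 2 * j + 2 * r = 2 * (a + j + r) + 1 by ring,
        show 2 * a + 1 + 2 * j = 2 * (a + j) + 1 by ring] at h1
      rw [(thueMorse_double _).2, (thueMorse_double _).2] at h1
      omega
  · rcases Nat.eq_zero_or_pos r with rfl | hr
    · exact thueMorse_not_three_equal i ⟨h 0 (by omega), h 1 (by omega)⟩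
    -- Odd period at least `3`: the shift moves two consecutive complementary pairs from even to odd
    -- positions, or conversely. Complementary pairs at odd positions force three equal consecutive
    -- terms at half the index.
    have h0 := h 0 (by omega)
    have h1 := h 1 (by omega)
    have h2 := h 2 (by omega)
    have h3 := h 3 (by omega)
    obtain ⟨a, rfl | rfl⟩ := Nat.even_or_odd' i
    · refine thueMorse_not_three_equal (a + r) ⟨thueMorse_eq_of_odd ?_, thueMorse_eq_of_odd ?_⟩
      · rw [show 2 * (a + r) + 1 = 2 * a + 0 + (2 * r + 1) by ring,
          show 2 * (a + r) + 2 = 2 * a + 1 + (2 * r + 1) by ring, ← h0, ← h1]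
        exact thueMorse_ne_of_even a
      · rw [show 2 * (a + r + 1) + 1 = 2 * a + 2 + (2 * r + 1) by ring,
          show 2 * (a + r + 1) + 2 = 2 * a + 3 + (2 * r + 1) by ring, ← h2, ← h3]
        exact thueMorse_ne_of_even (a + 1)
    · refine thueMorse_not_three_equal a ⟨thueMorse_eq_of_odd ?_, thueMorse_eq_of_odd ?_⟩
      · rw [show 2 * a + 1 = 2 * a + 1 + 0 by ring,
          show 2 * a + 2 = 2 * a + 1 + 1 by ring, h0, h1,
          show 2 * a + 1 + 0 + (2 * r + 1) = 2 * (a + r + 1) by ring,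
          show 2 * a + 1 + 1 + (2 * r + 1) = 2 * (a + r + 1) + 1 by ring]
        exact thueMorse_ne_of_even _
      · rw [show 2 * (a + 1) + 1 = 2 * a + 1 + 2 by ring,
          show 2 * (a + 1) + 2 = 2 * a + 1 + 3 by ring, h2, h3,
          show 2 * a + 1 + 2 + (2 * r + 1) = 2 * (a + r + 2) by ring,
          show 2 * a + 1 + 3 + (2 * r + 1) = 2 * (a + r + 2) + 1 by ring]
        exact thueMorse_ne_of_even _

theorem length_diffThueMorse (k : ℕ) : (diffThueMorse k).length = k := by
  simp [diffThueMorse]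

/-- If the differences repeat with period `q`, then `τ (n + q) - τ n` is a constant `d` over the
square. Two shifts add `2 * d`, but the terms are `0` or `1`, so `d = 0` and the sequence has an
overlap. -/
theorem diffThueMorse_squareFree (k : ℕ) : SquareFreeList (diffThueMorse k) := by
  rintro u ⟨a, b, hab⟩
  by_contra hu
  have hq := List.length_pos_iff.mpr hu
  have hlen : a.length + 2 * u.length + b.length = k := by
    rw [← length_diffThueMorse k, ← hab]
    simp only [List.length_append]
    ring
  have hget : ∀ n, n < u.length + u.length → (u ++ u)[n]? =
      some (thueMorse (a.length + n + 1) - thueMorse (a.length + n)) := by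
    intro n hn
    have h1 : (diffThueMorse k)[a.length + n]? =
        some (thueMorse (a.length + n + 1) - thueMorse (a.length + n)) := by
      have : a.length + n < k := by omega
      simp [diffThueMorse, this]
    rw [← h1, ← hab, List.append_assoc, List.getElem?_append_right (l₁ := a) (by omega),
      Nat.add_sub_cancel_left, List.getElem?_append_left (l₁ := u ++ u) (by simpa using hn)]
  have hstep : ∀ n < u.length, thueMorse (a.length + n + 1) - thueMorse (a.length + n) =
      thueMorse (a.length + n + 1 + u.length) - thueMorse (a.length + n + u.length) := by
    intro n hn
    have h1 := hget n (by omega)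
    have h2 := hget (n + u.length) (by omega)
    rw [List.getElem?_append_left hn] at h1
    rw [List.getElem?_append_right (by omega), Nat.add_sub_cancel, h1] at h2
    rw [Option.some_inj.mp h2]
    congr 2 <;> ring
  have hdiff : ∀ n ≤ u.length, thueMorse (a.length + n + u.length) - thueMorse (a.length + n) =
      thueMorse (a.length + u.length) - thueMorse a.length := by
    intro n hn
    induction n with
    | zero => rfl
    | succ n ih =>
      have h1 := ih (by omega)
      have h2 := hstep n (by omega)
      rw [← add_assoc]
      omega
  refine thueMorse_overlapFree u.length hq a.length fun n hn => ?_
  have h1 := hdiff n hn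
  have h2 := hdiff u.length le_rfl
  have := thueMorse_eq_zero_or_one a.length
  have := thueMorse_eq_zero_or_one (a.length + u.length)
  have := thueMorse_eq_zero_or_one (a.length + u.length + u.length)
  omega

theorem diffThueMorse_prefix {k l : ℕ} (h : k ≤ l) : diffThueMorse k <+: diffThueMorse l := by
  obtain ⟨d, rfl⟩ := Nat.exists_eq_add_of_le h
  simp [diffThueMorse, List.range_add]

/-- The factor of length `l` at position `a` of the difference sequence. -/
def diffFactor (a l : ℕ) : List ℤ :=
  (List.range l).map fun i => thueMorse (a + i + 1) - thueMorse (a + i)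

theorem diffThueMorse_add (a l : ℕ) :
    diffThueMorse (a + l) = diffThueMorse a ++ diffFactor a l := by
  simp [diffThueMorse, diffFactor, List.range_add, Function.comp_def]

theorem diffFactor_infix {a l k : ℕ} (h : a + l ≤ k) : diffFactor a l <:+: diffThueMorse k := by
  refine List.IsInfix.trans ?_ (diffThueMorse_prefix h).isInfix
  rw [diffThueMorse_add]
  exact (List.suffix_append _ _).isInfix

theorem diffFactor_congr {a b l : ℕ}
    (h : ∀ i ≤ l, thueMorse (a + i) = thueMorse (b + i)) : diffFactor a l = diffFactor b l := by
  refine List.map_congr_left fun i hi => ?_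
  have hi := List.mem_range.mp hi
  have h1 := h i hi.le
  have h2 := h (i + 1) hi
  rw [← add_assoc, ← add_assoc] at h2
  rw [h1, h2]

theorem diffFactor_one (a : ℕ) : ∃ c, diffFactor a 1 = [c] := by
  simp [diffFactor]

/-- Agreement of `l + 1` terms gives `l` equal differences, copied in one phrase. The next
difference leaves the matching range and is read as a single letter. -/
theorem Factors.diffThueMorse_extend {a b l r : ℕ} (hab : b + l ≤ a)
    (hc : ∀ i ≤ l, thueMorse (a + i) = thueMorse (b + i))
    (h : Factors [] (diffThueMorse a) r) : Factors [] (diffThueMorse (a + l + 1)) (r + 2) := by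
  obtain ⟨c, hc'⟩ := diffFactor_one (a + l)
  rw [diffThueMorse_add, diffThueMorse_add, hc']
  refine (h.append ?_).append (r' := 1) (Factors.singleton _ _)
  rw [diffFactor_congr hc]
  exact Factors.of_infix (diffFactor_infix hab)

/-- With `X` the prefix of length `2 ^ m` and `Y` its negation, the sequence starts with `X Y Y X`.
Doubling `X Y` thus takes two copies, of `Y` and of `X`, each followed by one letter. -/
theorem factors_diffThueMorse (m : ℕ) : Factors [] (diffThueMorse (2 ^ (m + 1))) (4 * m + 2) := by
  induction m with
  | zero =>
    exact (Factors.singleton [] _).append (Factors.singleton _ _)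
  | succ m ih =>
    have hpos := Nat.two_pow_pos m
    have h1 : ∀ i ≤ 2 ^ m - 1, thueMorse (2 ^ (m + 1) + i) = thueMorse (2 ^ m + i) := by
      intro i hi
      rw [thueMorse_two_pow_add _ _ (by rw [pow_succ]; omega), thueMorse_two_pow_add _ _ (by omega)]
    have h2 : ∀ i ≤ 2 ^ m - 1, thueMorse (2 ^ (m + 1) + (2 ^ m - 1) + 1 + i) =
        thueMorse (0 + i) := by
      intro i hi
      rw [show 2 ^ (m + 1) + (2 ^ m - 1) + 1 + i = 2 ^ (m + 1) + (2 ^ m + i) by omega,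
        thueMorse_two_pow_add _ _ (by rw [pow_succ]; omega), thueMorse_two_pow_add _ _ (by omega),
        zero_add]
      ring
    have h3 := (ih.diffThueMorse_extend (by rw [pow_succ]; omega) h1).diffThueMorse_extend
      (by omega) h2
    convert h3 using 2
    · rw [pow_succ, pow_succ]
      omega
    · ring

end ThueMorse

/-! ### Strings of blocks with distinct separators -/

section Separated

variable {α β : Type*}

theorem List.infix_of_infix_append_cons {x l₁ l₂ : List α} {c : α} (hc : c ∉ x)
    (h : x <:+: l₁ ++ c :: l₂) : x <:+: l₁ ∨ x <:+: l₂ := by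
  obtain ⟨s, t, h⟩ := h
  rw [List.append_assoc, List.append_eq_append_iff] at h
  rcases h with ⟨a, rfl, h⟩ | ⟨a, rfl, h⟩
  · rw [List.append_eq_append_iff] at h
    rcases h with ⟨b, rfl, -⟩ | ⟨b, rfl, h⟩
    · exact Or.inl ⟨s, b, by simp⟩
    · rcases b with - | ⟨d, b⟩
      · exact Or.inl ⟨s, [], by simp⟩
      · obtain ⟨rfl, -⟩ := List.cons.inj h
        simp at hc
  · rcases a with - | ⟨d, a⟩
    · rcases x with - | ⟨d, x⟩
      · exact Or.inl List.nil_infix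
      · obtain ⟨rfl, -⟩ := List.cons.inj h
        simp at hc
    · obtain ⟨-, rfl⟩ := List.cons.inj h
      exact Or.inr ⟨a, t, by simp⟩

/-- A square contains each of its letters at least twice, so it avoids `c` and lies on one side of
it. -/
theorem SquareFreeList.append_cons {l₁ l₂ : List α} {c : α} (h₁ : SquareFreeList l₁)
    (h₂ : SquareFreeList l₂) (hc₁ : c ∉ l₁) (hc₂ : c ∉ l₂) : SquareFreeList (l₁ ++ c :: l₂) := by
  classical
  intro u hu
  have hc : c ∉ u := by
    intro hcu
    have h1 := hu.sublist.count_le c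
    rw [List.count_append, List.count_append, List.count_cons_self,
      List.count_eq_zero_of_not_mem hc₁, List.count_eq_zero_of_not_mem hc₂] at h1
    have := List.count_pos_iff.mpr hcu
    omega
  exact (List.infix_of_infix_append_cons (by simpa using hc) hu).elim (h₁ u) (h₂ u)

theorem SquareFreeList.map {f : α → β} (hf : Function.Injective f) {s : List α}
    (hs : SquareFreeList s) : SquareFreeList (s.map f) := by
  rintro u ⟨a, b, h⟩
  obtain ⟨l, l', rfl, h1, -⟩ := List.map_eq_append_iff.mp h.symm
  obtain ⟨l₁, l₂, rfl, -, h2⟩ := List.map_eq_append_iff.mp h1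
  obtain ⟨u₁, u₂, rfl, h3, h4⟩ := List.map_eq_append_iff.mp h2
  obtain rfl : u₁ = u₂ := hf.list_map (h3.trans h4.symm)
  rw [← h3, hs u₁ ⟨l₁, l', rfl⟩, List.map_nil]

theorem separated_one (w : ℕ → List α) : separated 1 w = (w 1).map Sum.inl := by
  simp [separated]

theorem separated_succ (n : ℕ) (w : ℕ → List α) : separated (n + 2) w =
    separated (n + 1) w ++ Sum.inr (n + 1) :: (w (n + 2)).map Sum.inl := by
  simp [separated, List.range_succ]

theorem inr_mem_separated {n c : ℕ} {w : ℕ → List α} (h : Sum.inr c ∈ separated (n + 1) w) :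
    c ≤ n := by
  induction n with
  | zero => simp [separated_one] at h
  | succ n ih =>
    rw [separated_succ, List.mem_append, List.mem_cons] at h
    rcases h with h | h | h
    · exact (ih h).trans (Nat.le_succ n)
    · exact (Sum.inr.inj h).le
    · simp at h

theorem separated_squareFree (n : ℕ) {w : ℕ → List α} (hw : ∀ i, SquareFreeList (w i)) :
    SquareFreeList (separated (n + 1) w) := by
  induction n with
  | zero => rw [separated_one]; exact (hw 1).map Sum.inl_injective
  | succ n ih =>
    rw [separated_succ]
    refine ih.append_cons ((hw _).map Sum.inl_injective) (fun h => ?_) (by simp)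
    have := inr_mem_separated h
    omega

theorem separated_injective (n : ℕ) {w w' : ℕ → List α}
    (h : separated (n + 1) w = separated (n + 1) w') : ∀ i ∈ Set.Icc 1 (n + 1), w i = w' i := by
  induction n with
  | zero =>
    rintro i ⟨h1, h2⟩
    obtain rfl : i = 1 := by omega
    rw [separated_one, separated_one] at h
    exact Sum.inl_injective.list_map h
  | succ n ih =>
    rintro i ⟨h1, h2⟩
    rw [separated_succ, separated_succ] at h
    have hnot : Sum.inr (n + 1) ∉ separated (n + 1) w := fun hw => by
      have := inr_mem_separated hw
      omega
    obtain ⟨h3, -, h4⟩ := (List.append_cons_inj_of_notMem hnot (by simp)).mp h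
    rcases Nat.lt_succ_iff_lt_or_eq.mp (Nat.lt_succ_of_le h2) with h5 | rfl
    · exact ih h3 i ⟨h1, by omega⟩
    · exact Sum.inl_injective.list_map h4

theorem map_separated (f : α → β) (p : ℕ) (w : ℕ → List α) :
    (separated p w).map (Sum.map f id) = separated p fun i => (w i).map f := by
  simp [separated, List.map_flatMap, Function.comp_def]

theorem length_separated_le (n b : ℕ) {w : ℕ → List α}
    (hw : ∀ i ∈ Set.Icc 1 (n + 1), (w i).length ≤ b) :
    (separated (n + 1) w).length ≤ (n + 1) * (b + 1) := by
  induction n with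
  | zero => simpa [separated_one] using (hw 1 (by simp)).trans (Nat.le_succ b)
  | succ n ih =>
    have h1 := ih fun i hi => hw i ⟨hi.1, hi.2.trans (Nat.le_succ _)⟩
    have h2 := hw (n + 2) ⟨by omega, le_rfl⟩
    rw [separated_succ, List.length_append, List.length_cons, List.length_map]
    rw [show (n + 1 + 1) * (b + 1) = (n + 1) * (b + 1) + (b + 1) by ring]
    omega

theorem prefix_separated (p : ℕ) (w : ℕ → List α) : (w 1).map Sum.inl <+: separated p w :=
  List.prefix_append _ _

theorem Factors.separated {w : ℕ → List α} {r : ℕ} (h : Factors [] (w 1) r) (n : ℕ)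
    (hw : ∀ i ∈ Set.Icc 1 (n + 1), w i <:+: w 1) :
    Factors [] (separated (n + 1) w) (r + 2 * n) := by
  induction n with
  | zero => rw [separated_one]; exact h.map Sum.inl
  | succ n ih =>
    have h1 := ih fun i hi => hw i ⟨hi.1, hi.2.trans (Nat.le_succ _)⟩
    have h2 := hw (n + 2) ⟨by omega, le_rfl⟩
    rw [separated_succ, List.append_cons]
    refine (h1.append (r' := 1) (Factors.singleton _ _)).append (r' := 1) (Factors.of_infix ?_)
    refine (h2.map Sum.inl).trans ((prefix_separated (n + 1) w).isInfix.trans ?_)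
    exact (List.prefix_append _ [Sum.inr (n + 1)]).isInfix

theorem map_diffString (p : ℕ) (k : ℕ → ℕ) :
    (diffString p k).map (Sum.map (fun _ => ()) id) = unaryString p k := by
  simp [diffString, unaryString, map_separated, length_diffThueMorse]

/-- Merging all block letters into one, with the separators kept, sends `t(k)` to `x ^ k`. -/
theorem minSLPSize_unaryString_le (n : ℕ) (k : ℕ → ℕ) :
    minSLPSize (unaryString (n + 1) k) ≤ minRLSLPSize (diffString (n + 1) k) := by
  rw [← map_diffString]
  exact minSLPSize_map_le_minRLSLPSize _
    (separated_squareFree n fun i => diffThueMorse_squareFree (k i))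

end Separated

/-! ### Choice of the exponents -/

section Counting

/-- The numbers `4 ^ j, f 0 + 1, 2 ^ j + f 1 + 1, …, (j - 1) * 2 ^ j + f (j - 1) + 1`, indexed
from `1`. -/
def exponents (j : ℕ) (f : ℕ → ℕ) (i : ℕ) : ℕ :=
  if i ≤ 1 then 4 ^ j else (i - 2) * 2 ^ j + f (i - 2) + 1

theorem exponents_one (j : ℕ) (f : ℕ → ℕ) : exponents j f 1 = 4 ^ j := by simp [exponents]

theorem exponents_add_two (j : ℕ) (f : ℕ → ℕ) (i : ℕ) :
    exponents j f (i + 2) = i * 2 ^ j + f i + 1 := by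
  simp [exponents]

theorem exponents_add_two_le {j : ℕ} {f : ℕ → ℕ} (hf : ∀ i, f i < 2 ^ j) (i : ℕ) :
    exponents j f (i + 2) ≤ (i + 1) * 2 ^ j := by
  have := hf i
  rw [exponents_add_two, add_mul]
  omega

theorem lt_exponents_add_two (j : ℕ) (f : ℕ → ℕ) (i : ℕ) :
    i * 2 ^ j < exponents j f (i + 2) := by
  rw [exponents_add_two]
  omega

theorem exponents_lt {j : ℕ} {f : ℕ → ℕ} (hf : ∀ i, f i < 2 ^ j) {i : ℕ} (hi : i < j) :
    exponents j f (i + 2) < 4 ^ j := by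
  refine (exponents_add_two_le hf i).trans_lt ?_
  rw [show (4 : ℕ) = 2 * 2 from rfl, mul_pow]
  exact Nat.mul_lt_mul_of_pos_right ((Nat.succ_le_of_lt hi).trans_lt Nat.lt_two_pow_self)
    (Nat.two_pow_pos j)

theorem exponents_pos_le {j : ℕ} {f : ℕ → ℕ} (hf : ∀ i, f i < 2 ^ j) {i : ℕ}
    (hi : i ∈ Set.Icc 1 (j + 1)) : 0 < exponents j f i ∧ exponents j f i ≤ exponents j f 1 := by
  rw [exponents_one]
  obtain ⟨h1, h2⟩ := hi
  rcases h1.eq_or_lt with rfl | h1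
  · rw [exponents_one]; exact ⟨by positivity, le_rfl⟩
  · obtain ⟨i, rfl⟩ := Nat.exists_eq_add_of_le' h1
    exact ⟨(lt_exponents_add_two j f i).pos, (exponents_lt hf (by omega)).le⟩

theorem exponents_strictMono {j : ℕ} {f : ℕ → ℕ} (hf : ∀ i, f i < 2 ^ j) :
    StrictMono fun i => exponents j f (i + 2) :=
  strictMono_nat_of_lt_succ fun i =>
    (exponents_add_two_le hf i).trans_lt (lt_exponents_add_two j f (i + 1))

theorem exponents_injOn {j : ℕ} {f : ℕ → ℕ} (hf : ∀ i, f i < 2 ^ j) :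
    Set.InjOn (exponents j f) (Set.Icc 1 (j + 1)) := by
  rintro a ⟨ha1, ha2⟩ b ⟨hb1, hb2⟩ h
  rcases ha1.eq_or_lt with rfl | ha1 <;> rcases hb1.eq_or_lt with rfl | hb1
  · rfl
  · obtain ⟨b, rfl⟩ := Nat.exists_eq_add_of_le' hb1
    rw [exponents_one] at h
    exact absurd h (exponents_lt hf (by omega)).ne'
  · obtain ⟨a, rfl⟩ := Nat.exists_eq_add_of_le' ha1
    rw [exponents_one] at h
    exact absurd h (exponents_lt hf (by omega)).ne
  · obtain ⟨a, rfl⟩ := Nat.exists_eq_add_of_le' ha1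
    obtain ⟨b, rfl⟩ := Nat.exists_eq_add_of_le' hb1
    rw [(exponents_strictMono hf).injective h]

open Classical in
/-- The letters of `unaryString (n + 1) k` and the empty string. -/
noncomputable def unaryLetters (n : ℕ) : Finset (List (Unit ⊕ ℕ)) :=
  insert [] (insert [Sum.inl ()] ((Finset.range (n + 1)).image fun i => [Sum.inr i]))

theorem card_unaryLetters_le (n : ℕ) : (unaryLetters n).card ≤ n + 3 := by
  classical
  refine (Finset.card_insert_le _ _).trans (Nat.succ_le_succ ?_)
  refine (Finset.card_insert_le _ _).trans (Nat.succ_le_succ ?_)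
  exact Finset.card_image_le.trans (Finset.card_range _).le

theorem singleton_mem_unaryLetters {n : ℕ} {k : ℕ → ℕ} {a : Unit ⊕ ℕ}
    (ha : a ∈ unaryString (n + 1) k) : [a] ∈ unaryLetters n := by
  classical
  rcases a with a | c
  · simp [unaryLetters]
  · have := inr_mem_separated ha
    simp [unaryLetters]
    omega

/-- If the strings of SLP size at most `g` are too few, then some choice of exponents gives a string
with no SLP of size `g`. -/
theorem exists_lt_minSLPSize {j g : ℕ} (h : (j + 3 + g) ^ (2 * g + 1) < 2 ^ (j * j)) :
    ∃ f : ℕ → ℕ, (∀ i, f i < 2 ^ j) ∧ g < minSLPSize (unaryString (j + 1) (exponents j f)) := by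
  classical
  by_contra! hcon
  -- Only the first `j` values matter; the default `0` keeps the bound `2 ^ j` for all indices.
  let ext : (Fin j → Fin (2 ^ j)) → ℕ → ℕ := fun F i => if hi : i < j then (F ⟨i, hi⟩).val else 0
  have hext : ∀ F i, ext F i < 2 ^ j := by
    intro F i
    simp only [ext]
    split_ifs
    · exact (F _).isLt
    · exact Nat.two_pow_pos j
  have hmaps : ∀ F ∈ (Finset.univ : Finset (Fin j → Fin (2 ^ j))),
      unaryString (j + 1) (exponents j (ext F)) ∈ chainStrings (unaryLetters j) g := fun F _ =>
    mem_chainStrings_of_minSLPSize_le (Finset.mem_insert_self _ _)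
      (fun a ha => singleton_mem_unaryLetters ha) (hcon _ (hext F))
  have hinj : Set.InjOn (fun F => unaryString (j + 1) (exponents j (ext F)))
      (Finset.univ : Finset (Fin j → Fin (2 ^ j))) := by
    intro F _ F' _ he
    funext i
    have h1 := congrArg List.length
      (separated_injective j he (i.val + 2) ⟨by omega, by have := i.isLt; omega⟩)
    simp only [List.length_replicate, exponents_add_two] at h1
    have h2 : ext F i = ext F' i := by omega
    simpa [ext, Fin.ext_iff] using h2
  have h1 := Finset.card_le_card_of_injOn _ hmaps hinj
  rw [Finset.card_univ, Fintype.card_fun, Fintype.card_fin, Fintype.card_fin, ← pow_mul] at h1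
  have h2 := h1.trans (card_chainStrings_le _ _)
  exact absurd ((h2.trans (Nat.pow_le_pow_left
    (Nat.add_le_add_right (card_unaryLetters_le j) g) _)).trans_lt h) (lt_irrefl _)

theorem six_mul_log_lt {j : ℕ} (hj : 64 ≤ j) : 6 * (Nat.log 2 j + 1) < j := by
  have h : ∀ n, 6 ≤ n → 6 * (n + 1) < 2 ^ n := by
    intro n hn
    induction n, hn using Nat.le_induction with
    | base => norm_num
    | succ n hn ih => rw [pow_succ]; omega
  exact (h _ (Nat.le_log_of_pow_le (by norm_num) (by simpa using hj))).trans_le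
    (Nat.pow_log_le_self 2 (by omega))

/-- Small `j` get a dummy `f`, so that a choice exists for every `j`; the lower bound is only needed
eventually. -/
theorem exists_exponents (j : ℕ) : ∃ f : ℕ → ℕ, (∀ i, f i < 2 ^ j) ∧ (64 ≤ j →
    j * j ≤ 12 * (Nat.log 2 j + 1) * minSLPSize (unaryString (j + 1) (exponents j f))) := by
  by_cases hj : 64 ≤ j
  swap
  · exact ⟨fun _ => 0, fun _ => Nat.two_pow_pos j, fun h => absurd h hj⟩
  set L := Nat.log 2 j + 1 with hL
  set g := j * j / (12 * L) with hg
  have hL6 : 6 * L < j := six_mul_log_lt hj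
  have hjL : j < 2 ^ L := Nat.lt_pow_succ_log_self (by norm_num) j
  have h1 : 12 * L * g ≤ j * j := Nat.mul_div_le _ _
  have h2 : 12 * g ≤ j * j := le_trans (Nat.mul_le_mul_right g (by omega)) h1
  have h3 : j + 3 + g ≤ 2 ^ (2 * L) := by
    calc j + 3 + g ≤ j * j := by nlinarith
      _ ≤ 2 ^ L * 2 ^ L := Nat.mul_le_mul hjL.le hjL.le
      _ = 2 ^ (2 * L) := by ring
  obtain ⟨f, hf, hfg⟩ := exists_lt_minSLPSize (j := j) (g := g) <| calc
    (j + 3 + g) ^ (2 * g + 1) ≤ (2 ^ (2 * L)) ^ (2 * g + 1) := Nat.pow_le_pow_left h3 _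
    _ = 2 ^ (2 * L * (2 * g + 1)) := by rw [← pow_mul]
    -- The exponent is `4 * L * g + 2 * L`: the first term is at most a third of `j * j` by the
    -- choice of `g`, the second is below `j / 3`.
    _ < 2 ^ (j * j) := Nat.pow_lt_pow_right (by norm_num) (by nlinarith)
  refine ⟨f, hf, fun _ => ?_⟩
  have h4 : j * j < 12 * L * (g + 1) := Nat.lt_mul_div_succ _ (by omega)
  exact h4.le.trans (Nat.mul_le_mul_left _ hfg)

end Counting

/-! ### Translation into asymptotic bounds -/

section Asymptotics

theorem natLog_add_one_le {j : ℕ} (hj : 64 ≤ j) : ((Nat.log 2 j + 1 : ℕ) : ℝ) ≤ 3 * Real.log j := by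
  have hj0 : (64 : ℝ) ≤ j := by exact_mod_cast hj
  have h1 : ((2 : ℝ) ^ Nat.log 2 j) ≤ j := by exact_mod_cast Nat.pow_log_le_self 2 (by omega)
  have h2 := Real.log_le_log (by positivity) h1
  rw [Real.log_pow] at h2
  have h3 := Real.log_two_gt_d9
  have h4 : 6 * Real.log 2 ≤ Real.log j := by
    rw [← Real.log_rpow (by norm_num)]
    exact Real.log_le_log (by positivity) (by norm_num; linarith)
  push_cast
  nlinarith

theorem one_le_log_four : 1 ≤ Real.log 4 ∧ Real.log 4 ≤ 2 := by
  have h : Real.log 4 = 2 * Real.log 2 := by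
    rw [show (4 : ℝ) = 2 ^ 2 by norm_num, Real.log_pow]
    norm_num
  have := Real.log_two_gt_d9
  have := Real.log_two_lt_d9
  constructor <;> linarith

theorem log_exponents_one (j : ℕ) (f : ℕ → ℕ) :
    Real.log (exponents j f 1) = j * Real.log 4 := by
  rw [exponents_one]
  push_cast
  rw [Real.log_pow]

theorem exponents_one_le_length (j n : ℕ) (f : ℕ → ℕ) :
    4 ^ j ≤ (diffString n (exponents j f)).length := by
  have h := (prefix_separated n fun i => diffThueMorse (exponents j f i)).length_le
  rwa [List.length_map, length_diffThueMorse, exponents_one] at h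

theorem log_length_diffString {j : ℕ} (hj : 1 ≤ j) {f : ℕ → ℕ} (hf : ∀ i, f i < 2 ^ j) :
    (j : ℝ) ≤ Real.log (diffString (j + 1) (exponents j f)).length ∧
      Real.log (diffString (j + 1) (exponents j f)).length ≤ 6 * j := by
  obtain ⟨h4, h4'⟩ := one_le_log_four
  have h1 := exponents_one_le_length j (j + 1) f
  have h2 : (diffString (j + 1) (exponents j f)).length ≤ (j + 1) * (4 ^ j + 1) := by
    refine length_separated_le j (4 ^ j) fun i hi => ?_
    rw [length_diffThueMorse, ← exponents_one j f]
    exact (exponents_pos_le hf hi).2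
  have h3 : (diffString (j + 1) (exponents j f)).length ≤ (4 ^ j) ^ 3 := by
    have h5 : j + 1 ≤ 4 ^ j := Nat.lt_pow_self (by norm_num)
    have h6 : 4 ^ 1 ≤ 4 ^ j := Nat.pow_le_pow_right (by norm_num) hj
    calc _ ≤ _ := h2
      _ ≤ 4 ^ j * (4 ^ j * 4 ^ j) := Nat.mul_le_mul h5 (by nlinarith)
      _ = _ := by ring
  have hpos : (0 : ℝ) < 4 ^ j := by positivity
  have h1' : (4 : ℝ) ^ j ≤ (diffString (j + 1) (exponents j f)).length := by exact_mod_cast h1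
  have h3' : ((diffString (j + 1) (exponents j f)).length : ℝ) ≤ (4 ^ j) ^ 3 := by
    exact_mod_cast h3
  have h7 := Real.log_le_log hpos h1'
  have h8 := Real.log_le_log (hpos.trans_le h1') h3'
  rw [Real.log_pow, Real.log_pow] at h8
  rw [Real.log_pow] at h7
  have hj0 : (0 : ℝ) ≤ j := j.cast_nonneg
  push_cast at h8
  constructor <;> nlinarith

theorem lzNo_diffString_le {j : ℕ} (hj : 1 ≤ j) {f : ℕ → ℕ} (hf : ∀ i, f i < 2 ^ j) :
    lzNo (diffString (j + 1) (exponents j f)) ≤ 10 * j := by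
  obtain ⟨i, rfl⟩ := Nat.exists_eq_add_of_le' hj
  have h1 : Factors [] (diffThueMorse (exponents (i + 1) f 1)) (4 * (2 * i + 1) + 2) := by
    -- Here `4 ^ (i + 1) = 2 ^ (2 * i + 2)`. The total is `4 * (2 * i + 1) + 2 + 2 * (i + 1) ≤ 10 *
    -- (i + 1)`.
    have h2 := factors_diffThueMorse (2 * i + 1)
    rwa [show 2 * i + 1 + 1 = 2 * (i + 1) by ring, pow_mul, show 2 ^ 2 = 4 from rfl,
      ← exponents_one (i + 1) f] at h2
  have h3 := Factors.separated (w := fun l => diffThueMorse (exponents (i + 1) f l)) h1 (i + 1)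
    fun l hl => (diffThueMorse_prefix (exponents_pos_le hf hl).2).isInfix
  have h4 : lzNo (diffString (i + 1 + 1) (exponents (i + 1) f)) ≤ _ := Factors.lzNo_le h3
  omega

theorem isTheta_length (f : ℕ → ℕ → ℕ) :
    (fun j : ℕ => ((j + 1 : ℕ) : ℝ)) =Θ[atTop] fun j => Real.log (exponents j (f j) 1) := by
  obtain ⟨h4, h4'⟩ := one_le_log_four
  simp only [log_exponents_one]
  constructor
  · refine IsBigO.of_bound 2 ?_
    filter_upwards [eventually_ge_atTop 1] with j hj
    have hj' : (1 : ℝ) ≤ j := by exact_mod_cast hj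
    rw [Real.norm_of_nonneg (by positivity), Real.norm_of_nonneg (by positivity)]
    push_cast
    nlinarith
  · refine IsBigO.of_bound 2 (Eventually.of_forall fun j => ?_)
    have hj' : (0 : ℝ) ≤ j := j.cast_nonneg
    rw [Real.norm_of_nonneg (by positivity), Real.norm_of_nonneg (by positivity)]
    push_cast
    nlinarith

theorem sq_le_log_mul {j m : ℕ} (hj : 64 ≤ j) (h : j * j ≤ 12 * (Nat.log 2 j + 1) * m) :
    (j : ℝ) ^ 2 / Real.log j ≤ 36 * m := by
  have h1 := natLog_add_one_le hj
  have h2 : (j : ℝ) * j ≤ 12 * (Nat.log 2 j + 1 : ℕ) * m := by exact_mod_cast h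
  have h3 : 0 < Real.log j := Real.log_pos (by exact_mod_cast (show 1 < j by omega))
  have hm : (0 : ℝ) ≤ m := m.cast_nonneg
  rw [div_le_iff₀ h3]
  nlinarith [mul_le_mul_of_nonneg_right h1 hm]

theorem isBigO_minSLPSize {f : ℕ → ℕ → ℕ} (hlow : ∀ j, 64 ≤ j → j * j ≤ 12 * (Nat.log 2 j + 1) *
      minSLPSize (unaryString (j + 1) (exponents j (f j)))) :
    (fun j => Real.log (exponents j (f j) 1) ^ 2 / Real.log (Real.log (exponents j (f j) 1)))
      =O[atTop] fun j => (minSLPSize (unaryString (j + 1) (exponents j (f j))) : ℝ) := by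
  obtain ⟨h4, h4'⟩ := one_le_log_four
  -- `144 = 4 * 36`: squaring `log (k 1) ≤ 2 * j` gives `4`, and `sq_le_log_mul` gives `36`.
  refine IsBigO.of_bound 144 ?_
  filter_upwards [eventually_ge_atTop 64] with j hj
  have hj' : (64 : ℝ) ≤ j := by exact_mod_cast hj
  have h1 := sq_le_log_mul hj (hlow j hj)
  have h3 : 0 < Real.log j := Real.log_pos (by linarith)
  rw [log_exponents_one]
  have h5 : Real.log j ≤ Real.log (j * Real.log 4) := Real.log_le_log (by linarith) (by nlinarith)
  rw [Real.norm_of_nonneg (div_nonneg (by positivity) (h3.le.trans h5)),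
    Real.norm_of_nonneg (by positivity)]
  calc _ ≤ (j * 2) ^ 2 / Real.log j := by gcongr
    _ = 4 * ((j : ℝ) ^ 2 / Real.log j) := by ring
    _ ≤ _ := by linarith

theorem isBigO_ratio {f : ℕ → ℕ → ℕ} (hf : ∀ j i, f j i < 2 ^ j)
    (hlow : ∀ j, 64 ≤ j → j * j ≤ 12 * (Nat.log 2 j + 1) *
      minSLPSize (unaryString (j + 1) (exponents j (f j)))) {z : ℕ → ℕ}
    (hz : ∀ j, 0 < z j) (hz' : ∀ j, 1 ≤ j → z j ≤ 10 * j) :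
    (fun j => Real.log (diffString (j + 1) (exponents j (f j))).length /
          Real.log (Real.log (diffString (j + 1) (exponents j (f j))).length)) =O[atTop]
        (fun j => (minRLSLPSize (diffString (j + 1) (exponents j (f j))) : ℝ) / z j) := by
  -- `2160 = 6 * 10 * 36`, from `log n ≤ 6 * j`, `z j ≤ 10 * j` and `sq_le_log_mul`.
  refine IsBigO.of_bound 2160 ?_
  filter_upwards [eventually_ge_atTop 64] with j hj
  have hj' : (64 : ℝ) ≤ j := by exact_mod_cast hj
  have h1 := sq_le_log_mul hj (hlow j hj)
  have h2 : (minSLPSize (unaryString (j + 1) (exponents j (f j))) : ℝ) ≤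
      minRLSLPSize (diffString (j + 1) (exponents j (f j))) := by
    exact_mod_cast minSLPSize_unaryString_le j (exponents j (f j))
  obtain ⟨h6, h7⟩ := log_length_diffString (by omega) (hf j)
  have h3 : 0 < Real.log j := Real.log_pos (by linarith)
  have h5 := Real.log_le_log (by linarith) h6
  have hzpos : (0 : ℝ) < z j := by exact_mod_cast hz j
  have hzle : (z j : ℝ) ≤ 10 * j := by exact_mod_cast hz' j (by omega)
  rw [Real.norm_of_nonneg (div_nonneg (by linarith) (h3.le.trans h5)),
    Real.norm_of_nonneg (by positivity)]
  calc _ ≤ (6 * j) / Real.log j := by gcongr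
    _ = 60 * ((j : ℝ) ^ 2 / Real.log j / (10 * j)) := by field_simp; norm_num
    _ ≤ 60 * (36 * minRLSLPSize (diffString (j + 1) (exponents j (f j))) / (10 * j)) := by
      gcongr
      linarith
    _ ≤ 60 * (36 * minRLSLPSize (diffString (j + 1) (exponents j (f j))) / z j) := by gcongr
    _ = _ := by ring

end Asymptotics

theorem theorem1 :
    (∃ (p : ℕ → ℕ) (k : ℕ → ℕ → ℕ),
      -- the `j`-th sequence is `k j 1, …, k j (p j)`: distinct positive integers, the first largest
      (∀ j, 1 ≤ p j ∧ Set.InjOn (k j) (Set.Icc 1 (p j)) ∧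
        ∀ i ∈ Set.Icc 1 (p j), 0 < k j i ∧ k j i ≤ k j 1) ∧
      Tendsto (fun j => k j 1) atTop atTop ∧
      (fun j => (p j : ℝ)) =Θ[atTop] (fun j => Real.log (k j 1)) ∧
      -- the lower bound for ordinary grammars
      (fun j => Real.log (k j 1) ^ 2 / Real.log (Real.log (k j 1))) =O[atTop]
        (fun j => (minSLPSize (unaryString (p j) (k j)) : ℝ)) ∧
      -- the separation from LZ77 without overlaps and with overlaps
      (fun j => Real.log (diffString (p j) (k j)).length /
          Real.log (Real.log (diffString (p j) (k j)).length)) =O[atTop]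
        (fun j => (minRLSLPSize (diffString (p j) (k j)) : ℝ) / lzNo (diffString (p j) (k j))) ∧
      (fun j => Real.log (diffString (p j) (k j)).length /
          Real.log (Real.log (diffString (p j) (k j)).length)) =O[atTop]
        (fun j => (minRLSLPSize (diffString (p j) (k j)) : ℝ) / lz (diffString (p j) (k j)))) ∧
    (∀ {α : Type*} (s : List α), lz s ≤ lzNo s) ∧
    -- the sequence of differences is square-free
    (∀ (k : ℕ) (u : List ℤ), u ++ u <:+: diffThueMorse k → u = []) := by
  refine ⟨?_, fun s => lz_le_lzNo s, fun k => diffThueMorse_squareFree k⟩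
  choose f hf hlow using exists_exponents
  have hne : ∀ j, diffString (j + 1) (exponents j (f j)) ≠ [] := fun j =>
    List.length_pos_iff.mp ((Nat.pow_pos (by norm_num)).trans_le
      (exponents_one_le_length j (j + 1) (f j)))
  refine ⟨fun j => j + 1, fun j => exponents j (f j), fun j => ⟨Nat.le_add_left 1 j,
    exponents_injOn (hf j), fun i hi => exponents_pos_le (hf j) hi⟩, ?_, isTheta_length f,
    isBigO_minSLPSize hlow,
    isBigO_ratio hf hlow (fun j => (lz_pos (hne j)).trans_le (lz_le_lzNo _))
      fun j hj => lzNo_diffString_le hj (hf j),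
    isBigO_ratio hf hlow (fun j => lz_pos (hne j))
      fun j hj => (lz_le_lzNo _).trans (lzNo_diffString_le hj (hf j))⟩
  simp only [exponents_one]
  exact tendsto_pow_atTop_atTop_of_one_lt (by norm_num)
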